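/- Let $\mathbb X$ be a Polish space with Borel $\sigma$-field $\mathcal B$. Let $\mathcal B_b\subseteq\mathcal B$ be a family of sets, called bounded sets, which is closed under taking Borel subsets and under unions of two sets. Assume that $\mathcal B_b$ properly localizes $\mathbb X$, that is: - for every $B\in\mathcal B_b$ there is an open $U\in\mathcal B_b$ with $\overline B\subseteq U$; - there is a countable subfamily of $\mathcal B_b$ which covers $\mathbb X$ and such that every $B\in\mathcal B_b$ is contained in one of its members. Let $\mathcal M(\mathbb X)$ be the space of all Borel measures $\mu$ on $\mathbb X$ with $\mu(B)<\infty$ for all $B\in\mathcal B_b$, and write $\mu(f)=\int f\,d\mu$. Equip $\mathcal M(\mathbb X)$ with the vague topology, i.e. the smallest topology under which $\mu\mapsto\mu(f)$ is continuous for every nonnegative, bounded, continuous $f:\mathbb X\to\mathbb R$ whose support is a bounded set. A random measure on $\mathbb X$ is a random element of $\mathcal M(\mathbb X)$ with respect to the smallest $\sigma$-algebra under which the maps $\mu\mapsto\mu(B)$, $B\in\mathcal B_b$, are measurable. Convergence in distribution in $\mathcal M(\mathbb X)$, denoted $\xrightarrow{d}$, is understood with respect to the vague topology. **Proposition 4.1.**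 Let $d$ be a metric on $\mathbb X$ which generates the topology of $\mathbb X$ and is such that for every $B\in\mathcal B_b$ there exists $\varepsilon>0$ with $B^{\varepsilon}:=\{x\in\mathbb X: d(x,B)\le\varepsilon\}\in\mathcal B_b$. Let $N,N_1,N_2,\dots$ be random measures on $\mathbb X$, possibly defined on different probability spaces. Then $N_n\xrightarrow{d}N$ in $\mathcal M(\mathbb X)$ if and only if $$\mathbb E\big[e^{-N_n(f)}\big]\to\mathbb E\big[e^{-N(f)}\big]\qquad (n\to\infty)$$ for every nonnegative, bounded function $f:\mathbb X\to\mathbb R$ which is Lipschitz continuous with respect to $d$ and whose support is a bounded set. -/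

import Mathlib

open MeasureTheory Filter Topology
open scoped NNReal ENNReal

namespace VagueConvergence

/-- A (Borel) boundedness in `X`: a family of Borel sets, called bounded sets, which is closed under
taking Borel subsets and under unions of two sets. -/
structure Boundedness (X : Type*) [MeasurableSpace X] where
  /-- the family of bounded Borel sets -/
  sets : Set (Set X)
  measurableSet : ∀ B ∈ sets, MeasurableSet B
  mono : ∀ A B : Set X, MeasurableSet A → A ⊆ B → B ∈ sets → A ∈ sets
  union : ∀ A B : Set X, A ∈ sets → B ∈ sets → A ∪ B ∈ sets

section Boundedness

variable {X : Type*} [TopologicalSpace X] [MeasurableSpace X]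

/-- A subfamily `C` of the bounded sets is a basis if every bounded set is contained in some
member of `C`. -/
def Boundedness.IsBasis (𝓑 : Boundedness X) (C : Set (Set X)) : Prop :=
  C ⊆ 𝓑.sets ∧ ∀ B ∈ 𝓑.sets, ∃ K ∈ C, B ⊆ K

/-- A boundedness is proper if for each bounded `B` there is a bounded open set containing the
closure of `B`. -/
def Boundedness.IsProper (𝓑 : Boundedness X) : Prop :=
  ∀ B ∈ 𝓑.sets, ∃ U ∈ 𝓑.sets, IsOpen U ∧ closure B ⊆ U

/-- A boundedness properly localizes `X` if it is proper and has a countable basis which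
covers `X`. -/
def Boundedness.ProperlyLocalizes (𝓑 : Boundedness X) : Prop :=
  𝓑.IsProper ∧ ∃ C : Set (Set X), C.Countable ∧ 𝓑.IsBasis C ∧ ⋃₀ C = Set.univ

/-- Nonnegative bounded continuous functions on `X` whose support is a bounded set. -/
def CBPlus (𝓑 : Boundedness X) : Set (X → ℝ) :=
  {f | Continuous f ∧ (∀ x, 0 ≤ f x) ∧ (∃ C : ℝ, ∀ x, f x ≤ C) ∧ tsupport f ∈ 𝓑.sets}

end Boundedness

/-- Nonnegative bounded functions on the metric space `X` which are Lipschitz continuous and whose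
support is a bounded set (boundedness refers to `𝓑`, not to the metric). -/
def LBPlus {X : Type*} [MetricSpace X] [MeasurableSpace X] (𝓑 : Boundedness X) : Set (X → ℝ) :=
  {f | (∃ L : ℝ≥0, LipschitzWith L f) ∧ (∀ x, 0 ≤ f x) ∧ (∃ C : ℝ, ∀ x, f x ≤ C) ∧
    tsupport f ∈ 𝓑.sets}

/-- The space of locally finite measures: Borel measures that are finite on bounded sets. -/
@[ext]
structure LocallyFiniteMeasure {X : Type*} [MeasurableSpace X] (𝓑 : Boundedness X) where
  /-- the underlying measure -/
  toMeasure : Measure X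
  finite_on : ∀ B ∈ 𝓑.sets, toMeasure B < ∞

section LocallyFiniteMeasure

variable {X : Type*} [TopologicalSpace X] [MeasurableSpace X] (𝓑 : Boundedness X)

/-- The vague topology: the smallest topology for which `μ ↦ μ(f)` is continuous for every
nonnegative bounded continuous `f` with bounded support. -/
noncomputable instance vagueTopology : TopologicalSpace (LocallyFiniteMeasure 𝓑) :=
  ⨅ f ∈ CBPlus 𝓑, TopologicalSpace.induced
    (fun μ : LocallyFiniteMeasure 𝓑 => ∫ x, f x ∂μ.toMeasure) inferInstance

/-- The Borel σ-algebra of the vague topology; it is used for convergence in distribution. -/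
noncomputable instance vagueBorel : MeasurableSpace (LocallyFiniteMeasure 𝓑) :=
  borel (LocallyFiniteMeasure 𝓑)

instance vagueBorelSpace : BorelSpace (LocallyFiniteMeasure 𝓑) := ⟨rfl⟩

end LocallyFiniteMeasure

/-- The smallest σ-algebra on the space of locally finite measures for which `μ ↦ μ(B)` is
measurable for every bounded set `B`. -/
abbrev evaluationSigmaAlgebra {X : Type*} [MeasurableSpace X] (𝓑 : Boundedness X) :
    MeasurableSpace (LocallyFiniteMeasure 𝓑) :=
  ⨆ B ∈ 𝓑.sets, MeasurableSpace.comap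
    (fun μ : LocallyFiniteMeasure 𝓑 => μ.toMeasure B) inferInstance

/-- A random measure: a random element of the space of locally finite measures with respect to the
σ-algebra generated by the evaluations on bounded sets. -/
def IsRandomMeasure {X : Type*} [MeasurableSpace X] {𝓑 : Boundedness X}
    {Ω : Type*} [MeasurableSpace Ω] (N : Ω → LocallyFiniteMeasure 𝓑) : Prop :=
  Measurable[inferInstance, evaluationSigmaAlgebra 𝓑] N

/-- The Laplace functional `𝔼[exp(-N(f))]`. -/
noncomputable def laplaceFunctional {X : Type*} [MeasurableSpace X] {𝓑 : Boundedness X}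
    {Ω : Type*} [MeasurableSpace Ω] (P : Measure Ω) (N : Ω → LocallyFiniteMeasure 𝓑)
    (f : X → ℝ) : ℝ :=
  ∫ ω, Real.exp (-∫ x, f x ∂(N ω).toMeasure) ∂P

end VagueConvergence

/-! One direction is immediate: `μ ↦ exp (-μ(f))` is bounded and vaguely continuous. For the
converse, a countable family `F` of Lipschitz test functions already induces the vague topology, so
`μ ↦ (exp (-μ(h)))_{h ∈ F}` is an inducing map into the compact cube `[0,1]^F`
(`IsDeterminingFamily.isInducing_expMap`). Products of coordinates of this map are again of the form
`exp (-μ(f))` with `f` a sum of members of `F`, hence Lipschitz. The hypothesis is thus convergence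
of the expectations of all monomials, and Stone–Weierstrass gives weak convergence on the cube
(`tendstoInDistribution_expMap`). The open-set form of the portmanteau theorem pulls this back along
the inducing map. Neither completeness of `d` nor a tightness argument is needed. -/

namespace VagueConvergence

/-! ### Approximating continuous functions from below by Lipschitz tents -/

section Tent

variable {X : Type*} [MetricSpace X]

/-- The function `y ↦ max 0 (q - s * d(x, y))`. -/
noncomputable def tent (x : X) (q : ℚ) (s : ℕ) (y : X) : ℝ :=
  max 0 (q - s * dist x y)

theorem lipschitzWith_tent (x : X) (q : ℚ) (s : ℕ) : LipschitzWith s (tent x q s) := by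
  refine LipschitzWith.const_max (LipschitzWith.of_dist_le_mul fun y z => ?_) 0
  rw [Real.dist_eq, NNReal.coe_natCast,
    show (q - s * dist x y : ℝ) - (q - s * dist x z) = s * (dist x z - dist x y) by ring, abs_mul,
    Nat.abs_cast]
  gcongr
  rw [dist_comm x z, dist_comm x y, dist_comm y z]
  exact abs_dist_sub_le z y x

theorem exists_tent_between {D : Set X} (hD : Dense D) {f : X → ℝ} (hf : Continuous f)
    (h0 : ∀ x, 0 ≤ f x) {y : X} {a : ℝ} (hay : a < f y) :
    ∃ x ∈ D, ∃ (q : ℚ) (s : ℕ), tent x q s ≤ f ∧ a < tent x q s y := by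
  obtain ⟨q, haq, hqf⟩ := exists_rat_btwn hay
  obtain ⟨δ, hδ, hball⟩ := Metric.eventually_nhds_iff.1 (hf.continuousAt.eventually_const_lt hqf)
  -- This slope makes the tent vanish at distance at least `δ / 2` from its centre.
  obtain ⟨s, hs⟩ := exists_nat_ge (q / (δ / 2) : ℝ)
  have hs' : (q : ℝ) ≤ s * (δ / 2) := by rwa [div_le_iff₀ (by positivity)] at hs
  -- The first bound keeps the tent's support within `δ` of `y`, where `f > q`; the second keeps its
  -- value at `y` above `a`, with `s + 1` guarding against `s = 0`.
  have hr : 0 < min (δ / 2) ((q - a) / (s + 1)) :=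
    lt_min (by positivity) (div_pos (by linarith) (by positivity))
  obtain ⟨x, hx, hxD⟩ := Metric.dense_iff.1 hD y _ hr
  rw [Metric.mem_ball, lt_min_iff] at hx
  refine ⟨x, hxD, q, s, fun z => max_le (h0 z) ?_, lt_max_of_lt_right ?_⟩
  · rcases le_or_gt (δ / 2) (dist x z) with hz | hz
    · have : (s : ℝ) * (δ / 2) ≤ s * dist x z := by gcongr
      linarith [h0 z]
    · have hzy : dist z y < δ := by
        linarith [dist_triangle z x y, dist_comm z x]
      have : (0 : ℝ) ≤ s * dist x z := by positivity
      linarith [hball hzy]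
  · have h2 : dist x y * (s + 1) < q - a := (lt_div_iff₀ (by positivity)).1 hx.2
    nlinarith [dist_nonneg (x := x) (y := y)]

end Tent

/-! ### Test functions and a countable family inducing the vague topology -/

section TestFunctions

variable {X : Type*} [MeasurableSpace X] {𝓑 : Boundedness X}

theorem Boundedness.tsupport_mem [TopologicalSpace X] [BorelSpace X] {f : X → ℝ} {A : Set X}
    (hA : A ∈ 𝓑.sets) (hc : IsClosed A) (h : ∀ x, f x ≠ 0 → x ∈ A) : tsupport f ∈ 𝓑.sets :=
  𝓑.mono _ A (isClosed_tsupport f).measurableSet (closure_minimal h hc) hA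

theorem Boundedness.tsupport_mem_of_union [TopologicalSpace X] [BorelSpace X] {f g h : X → ℝ}
    (hf : tsupport f ∈ 𝓑.sets) (hg : tsupport g ∈ 𝓑.sets)
    (hh : ∀ x, f x = 0 → g x = 0 → h x = 0) : tsupport h ∈ 𝓑.sets := by
  refine 𝓑.tsupport_mem (𝓑.union _ _ hf hg) ((isClosed_tsupport f).union (isClosed_tsupport g)) ?_
  intro x hx
  by_contra hx'
  rw [Set.mem_union, not_or] at hx'
  exact hx (hh x (image_eq_zero_of_notMem_tsupport hx'.1)
    (image_eq_zero_of_notMem_tsupport hx'.2))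

theorem continuous_integral [TopologicalSpace X] {f : X → ℝ} (hf : f ∈ CBPlus 𝓑) :
    Continuous fun μ : LocallyFiniteMeasure 𝓑 => ∫ x, f x ∂μ.toMeasure :=
  continuous_iff_le_induced.2 (iInf₂_le f hf)

theorem integrable_of_mem_CBPlus [TopologicalSpace X] [BorelSpace X] {f : X → ℝ}
    (hf : f ∈ CBPlus 𝓑) (μ : LocallyFiniteMeasure 𝓑) : Integrable f μ.toMeasure := by
  obtain ⟨hc, h0, ⟨C, hC⟩, hs⟩ := hf
  rw [← integrableOn_iff_integrable_of_support_subset (subset_tsupport f)]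
  refine Measure.integrableOn_of_bounded (M := C) (μ.finite_on _ hs).ne
    hc.measurable.aestronglyMeasurable (ae_of_all _ fun x => ?_)
  rw [Real.norm_of_nonneg (h0 x)]
  exact hC x

variable [MetricSpace X]

theorem LBPlus_subset_CBPlus : LBPlus 𝓑 ⊆ CBPlus 𝓑 :=
  fun _ ⟨⟨_, hL⟩, h⟩ => ⟨hL.continuous, h⟩

variable [BorelSpace X]

theorem supClosed_LBPlus : SupClosed (LBPlus 𝓑) := by
  rintro f ⟨⟨L, hL⟩, h0, ⟨C, hC⟩, hs⟩ g ⟨⟨L', hL'⟩, h0', ⟨C', hC'⟩, hs'⟩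
  refine ⟨⟨_, hL.max hL'⟩, fun x => le_sup_of_le_left (h0 x),
    ⟨max C C', fun x => max_le_max (hC x) (hC' x)⟩, 𝓑.tsupport_mem_of_union hs hs' ?_⟩
  intro x hx hx'
  simp [hx, hx']

theorem add_mem_LBPlus {f g : X → ℝ} (hf : f ∈ LBPlus 𝓑) (hg : g ∈ LBPlus 𝓑) :
    f + g ∈ LBPlus 𝓑 := by
  obtain ⟨⟨L, hL⟩, h0, ⟨C, hC⟩, hs⟩ := hf
  obtain ⟨⟨L', hL'⟩, h0', ⟨C', hC'⟩, hs'⟩ := hg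
  refine ⟨⟨_, hL.add hL'⟩, fun x => add_nonneg (h0 x) (h0' x),
    ⟨C + C', fun x => add_le_add (hC x) (hC' x)⟩, 𝓑.tsupport_mem_of_union hs hs' ?_⟩
  intro x hx hx'
  simp [hx, hx']

theorem tent_mem_LBPlus {f : X → ℝ} (hf : f ∈ CBPlus 𝓑) {x : X} {q : ℚ} {s : ℕ}
    (h : tent x q s ≤ f) : tent x q s ∈ LBPlus 𝓑 := by
  have h0 : ∀ y, 0 ≤ tent x q s y := fun y => le_max_left _ _
  refine ⟨⟨_, lipschitzWith_tent x q s⟩, h0, ?_, ?_⟩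
  · obtain ⟨C, hC⟩ := hf.2.2.1
    exact ⟨C, fun y => (h y).trans (hC y)⟩
  · refine 𝓑.tsupport_mem_of_union hf.2.2.2 hf.2.2.2 fun y hy _ => ?_
    exact le_antisymm ((h y).trans hy.le) (h0 y)

/-- The assumption on `d` enters here: the thickened indicator is Lipschitz and lives on the
`ε`-thickening, so its support is bounded. -/
theorem exists_LBPlus_one_le {B : Set X} {ε : ℝ} (hε : 0 < ε)
    (hB : Metric.cthickening ε B ∈ 𝓑.sets) : ∃ g ∈ LBPlus 𝓑, ∀ x ∈ B, 1 ≤ g x := by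
  refine ⟨fun x => thickenedIndicator hε B x,
    ⟨⟨_, lipschitzWith_thickenedIndicator hε B⟩, fun x => NNReal.coe_nonneg _,
      ⟨1, fun x => mod_cast thickenedIndicator_le_one hε B x⟩,
      𝓑.tsupport_mem hB Metric.isClosed_cthickening fun x hx => ?_⟩, fun x hx => ?_⟩
  · refine Metric.thickening_subset_cthickening ε B ?_
    by_contra hx'
    exact hx (by simp [thickenedIndicator_zero hε B hx'])
  · simp [thickenedIndicator_one hε B hx]

/-- A countable family of functions in `LBPlus 𝓑` that determines the vague topology. -/
structure IsDeterminingFamily (𝓑 : Boundedness X) (F : Set (X → ℝ)) : Prop where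
  countable : F.Countable
  subset : F ⊆ LBPlus 𝓑
  supClosed : SupClosed F
  exists_le : ∀ f ∈ CBPlus 𝓑, ∀ x a, 0 ≤ a → a < f x → ∃ h ∈ F, h ≤ f ∧ a < h x
  exists_one_le : ∀ B ∈ 𝓑.sets, ∃ g ∈ F, ∀ x ∈ B, 1 ≤ g x

theorem countable_supClosure {α : Type*} [SemilatticeSup α] {s : Set α} (hs : s.Countable) :
    (supClosure s).Countable := by
  have : Countable s := hs.to_subtype
  have hsub : supClosure s ⊆ Set.range fun t : {t : Finset s // t.Nonempty} =>
      t.1.sup' t.2 (fun a => (a : α)) := by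
    refine supClosure_min (fun a ha => ⟨⟨{⟨a, ha⟩}, by simp⟩, by simp⟩) ?_
    classical
    rintro _ ⟨t, rfl⟩ _ ⟨u, rfl⟩
    exact ⟨⟨t.1 ∪ u.1, t.2.mono Finset.subset_union_left⟩, Finset.sup'_union t.2 u.2 _⟩
  exact (Set.countable_range _).mono hsub

/-- Tents with centres in a countable dense set, rational heights and integer slopes approximate
from below; bumps over a countable basis dominate bounded sets. Closing under finite suprema
preserves countability. -/
theorem exists_isDeterminingFamily [SecondCountableTopology X] (h𝓑 : 𝓑.ProperlyLocalizes)
    (hd : ∀ B ∈ 𝓑.sets, ∃ ε : ℝ, 0 < ε ∧ Metric.cthickening ε B ∈ 𝓑.sets) :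
    ∃ F, IsDeterminingFamily 𝓑 F := by
  obtain ⟨D, hDc, hD⟩ := TopologicalSpace.exists_countable_dense X
  obtain ⟨-, C, hCc, hC, -⟩ := h𝓑
  have hbump : ∀ B : C, ∃ g ∈ LBPlus 𝓑, ∀ x ∈ B.1, 1 ≤ g x := fun B =>
    let ⟨_, hε, h⟩ := hd _ (hC.1 B.2)
    exists_LBPlus_one_le hε h
  choose g hg hg1 using hbump
  have := hDc.to_subtype
  have := hCc.to_subtype
  let T : Set (X → ℝ) := Set.range fun p : D × ℚ × ℕ => tent p.1.1 p.2.1 p.2.2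
  have hT : (T ∩ LBPlus 𝓑 ∪ Set.range g).Countable :=
    ((Set.countable_range _).mono Set.inter_subset_left).union (Set.countable_range _)
  refine ⟨supClosure (T ∩ LBPlus 𝓑 ∪ Set.range g), countable_supClosure hT,
    supClosure_min (Set.union_subset Set.inter_subset_right (Set.range_subset_iff.2 hg))
      supClosed_LBPlus, supClosed_supClosure, fun f hf y a _ hay => ?_, fun B hB => ?_⟩
  · obtain ⟨x, hx, q, s, hle, hlt⟩ := exists_tent_between hD hf.1 hf.2.1 hay
    exact ⟨_, subset_supClosure (Or.inl ⟨⟨(⟨x, hx⟩, q, s), rfl⟩, tent_mem_LBPlus hf hle⟩),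
      hle, hlt⟩
  · obtain ⟨K, hK, hBK⟩ := hC.2 B hB
    exact ⟨g ⟨K, hK⟩, subset_supClosure (Or.inr ⟨_, rfl⟩), fun x hx => hg1 _ x (hBK hx)⟩

/-- `f` is the pointwise supremum of the members of `F` below it. They form a countable directed
family, so monotone convergence exchanges supremum and integral. -/
theorem IsDeterminingFamily.exists_lt_integral {F : Set (X → ℝ)} (hF : IsDeterminingFamily 𝓑 F)
    {f : X → ℝ} (hf : f ∈ CBPlus 𝓑) (μ : LocallyFiniteMeasure 𝓑) {a : ℝ} (ha : 0 ≤ a)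
    (hlt : a < ∫ x, f x ∂μ.toMeasure) : ∃ h ∈ F, h ≤ f ∧ a < ∫ x, h x ∂μ.toMeasure := by
  let β := {h : X → ℝ // h ∈ F ∧ h ≤ f}
  have : Countable β := (hF.countable.mono fun h hh => hh.1).to_subtype
  have hsup : ∀ x, ENNReal.ofReal (f x) = ⨆ h : β, ENNReal.ofReal (h.1 x) := by
    intro x
    refine le_antisymm (le_of_forall_lt fun c hc => ?_)
      (iSup_le fun h => ENNReal.ofReal_le_ofReal (h.2.2 x))
    obtain ⟨h, hhF, hle, hlt⟩ := hF.exists_le f hf x c.toReal ENNReal.toReal_nonneg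
      ((ENNReal.lt_ofReal_iff_toReal_lt hc.ne_top).1 hc)
    exact lt_iSup_iff.2 ⟨⟨h, hhF, hle⟩, (ENNReal.lt_ofReal_iff_toReal_lt hc.ne_top).2 hlt⟩
  have hcb : ∀ h : β, h.1 ∈ CBPlus 𝓑 := fun h => LBPlus_subset_CBPlus (hF.subset h.2.1)
  have hdir : Directed (· ≤ ·) fun (h : β) (x : X) => ENNReal.ofReal (h.1 x) := fun h k =>
    ⟨⟨h.1 ⊔ k.1, hF.supClosed h.2.1 k.2.1, sup_le h.2.2 k.2.2⟩,
      fun x => ENNReal.ofReal_le_ofReal le_sup_left,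
      fun x => ENNReal.ofReal_le_ofReal le_sup_right⟩
  have hlin : ∀ {k}, k ∈ CBPlus 𝓑 →
      ENNReal.ofReal (∫ x, k x ∂μ.toMeasure) = ∫⁻ x, ENNReal.ofReal (k x) ∂μ.toMeasure :=
    fun hk => ofReal_integral_eq_lintegral_ofReal (integrable_of_mem_CBPlus hk μ)
      (ae_of_all _ hk.2.1)
  have hlt' := (ENNReal.ofReal_lt_ofReal_iff_of_nonneg ha).2 hlt
  rw [hlin hf, lintegral_congr hsup, lintegral_iSup_directed_of_measurable
    (fun h => (hcb h).1.measurable.ennreal_ofReal) hdir, lt_iSup_iff] at hlt'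
  obtain ⟨h, hh⟩ := hlt'
  rw [← hlin (hcb h), ENNReal.ofReal_lt_ofReal_iff_of_nonneg ha] at hh
  exact ⟨h.1, h.2.1, h.2.2, hh⟩

/-- The map sending a measure `μ` to the family `exp (-μ(h))`, `h ∈ F`. -/
noncomputable def expMap {F : Set (X → ℝ)} (hF : F ⊆ LBPlus 𝓑) (μ : LocallyFiniteMeasure 𝓑)
    (h : F) : unitInterval :=
  ⟨Real.exp (-∫ x, h.1 x ∂μ.toMeasure), (Real.exp_pos _).le,
    Real.exp_le_one_iff.2 (neg_nonpos.2 (integral_nonneg (hF h.2).2.1))⟩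

/-- In the induced topology `μ(h)`, `h ∈ F`, is continuous (take logarithms), so `μ(k)` is lower
semicontinuous for every `k ∈ CBPlus 𝓑`, being a supremum of such maps. Upper semicontinuity of
`μ(f)` follows from `μ(f) = |C| μ(g) - μ(|C| g - f)`, where `g ∈ F` is at least `1` on the support
of `f` and `f ≤ C`. -/
theorem IsDeterminingFamily.isInducing_expMap {F : Set (X → ℝ)} (hF : IsDeterminingFamily 𝓑 F) :
    IsInducing (expMap hF.subset) := by
  refine ⟨le_antisymm ?_ (le_iInf₂ fun f hf => ?_)⟩
  · refine continuous_iff_le_induced.1 (continuous_pi fun h => Continuous.subtype_mk ?_ _)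
    exact Real.continuous_exp.comp
      (continuous_integral (LBPlus_subset_CBPlus (hF.subset h.2))).neg
  · rw [← continuous_iff_le_induced]
    let t : TopologicalSpace (LocallyFiniteMeasure 𝓑) := .induced (expMap hF.subset) inferInstance
    have hcont : ∀ h ∈ F, Continuous[t, inferInstance]
        fun μ : LocallyFiniteMeasure 𝓑 => ∫ x, h x ∂μ.toMeasure := by
      intro h hh
      have h0 : Continuous[t, inferInstance] (expMap hF.subset) := continuous_induced_dom
      have h1 : Continuous[t, inferInstance] fun μ : LocallyFiniteMeasure 𝓑 =>
          Real.exp (-∫ x, h x ∂μ.toMeasure) :=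
        (show Continuous fun p : F → unitInterval => (p ⟨h, hh⟩ : ℝ) by fun_prop).comp h0
      simpa only [Real.log_exp, Pi.neg_def, neg_neg] using (h1.log fun μ => (Real.exp_pos _).ne').neg
    have hlsc : ∀ k ∈ CBPlus 𝓑, ∀ (μ : LocallyFiniteMeasure 𝓑) (a : ℝ),
        a < ∫ x, k x ∂μ.toMeasure → ∀ᶠ ν in @nhds _ t μ, a < ∫ x, k x ∂ν.toMeasure := by
      intro k hk μ a ha
      rcases lt_or_ge a 0 with h0 | h0
      · exact Eventually.of_forall fun ν => h0.trans_le (integral_nonneg hk.2.1)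
      · obtain ⟨h, hhF, hle, hlt⟩ := hF.exists_lt_integral hk μ h0 ha
        filter_upwards [(hcont h hhF).continuousAt.eventually_const_lt hlt] with ν hν
        exact hν.trans_le (integral_mono
          (integrable_of_mem_CBPlus (LBPlus_subset_CBPlus (hF.subset hhF)) ν)
          (integrable_of_mem_CBPlus hk ν) hle)
    obtain ⟨g, hgF, hg1⟩ := hF.exists_one_le _ hf.2.2.2
    have hg := LBPlus_subset_CBPlus (hF.subset hgF)
    obtain ⟨C, hC⟩ := hf.2.2.1
    obtain ⟨C', hC'⟩ := hg.2.2.1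
    have hk : (fun x => |C| * g x - f x) ∈ CBPlus 𝓑 := by
      refine ⟨(continuous_const.mul hg.1).sub hf.1, fun x => ?_, ⟨|C| * C', fun x => ?_⟩,
        𝓑.tsupport_mem_of_union hf.2.2.2 hg.2.2.2 fun x hx hx' => by simp [hx, hx']⟩
      · by_cases hx : x ∈ tsupport f
        · have := hg1 x hx
          nlinarith [hC x, le_abs_self C, abs_nonneg C]
        · simpa only [image_eq_zero_of_notMem_tsupport hx, sub_zero] using
            mul_nonneg (abs_nonneg C) (hg.2.1 x)
      · have := mul_le_mul_of_nonneg_left (hC' x) (abs_nonneg C)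
        linarith [hf.2.1 x]
    have hint : ∀ ν : LocallyFiniteMeasure 𝓑, ∫ x, (|C| * g x - f x) ∂ν.toMeasure
        = |C| * ∫ x, g x ∂ν.toMeasure - ∫ x, f x ∂ν.toMeasure := fun ν => by
      rw [integral_sub ((integrable_of_mem_CBPlus hg ν).const_mul _)
        (integrable_of_mem_CBPlus hf ν), integral_const_mul]
    refine continuous_iff_continuousAt.2 fun μ => tendsto_order.2 ⟨hlsc f hf μ, fun a ha => ?_⟩
    set η := (a - ∫ x, f x ∂μ.toMeasure) / 2 with hη
    have hη0 : 0 < η := by rw [hη]; linarith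
    have h1 := hlsc _ hk μ (∫ x, (|C| * g x - f x) ∂μ.toMeasure - η) (by linarith)
    have h2 := ((hcont g hgF).const_mul |C|).continuousAt.eventually_lt_const
      (show |C| * ∫ x, g x ∂μ.toMeasure < |C| * ∫ x, g x ∂μ.toMeasure + η by linarith)
    filter_upwards [h1, h2] with ν h1 h2
    rw [hint, hint] at h1
    linarith

end TestFunctions

/-! ### From evaluation measurability to vague Borel measurability -/

section Measurability

variable {X : Type*} [MeasurableSpace X] {𝓑 : Boundedness X} {Ω : Type*} [MeasurableSpace Ω]

theorem IsRandomMeasure.measurable_apply {N : Ω → LocallyFiniteMeasure 𝓑}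
    (hN : IsRandomMeasure N) {B : Set X} (hB : B ∈ 𝓑.sets) :
    Measurable fun ω => (N ω).toMeasure B := by
  have h : Measurable[evaluationSigmaAlgebra 𝓑]
      fun μ : LocallyFiniteMeasure 𝓑 => μ.toMeasure B :=
    Measurable.of_comap_le
      (le_iSup₂ (f := fun B (_ : B ∈ 𝓑.sets) => MeasurableSpace.comap
        (fun μ : LocallyFiniteMeasure 𝓑 => μ.toMeasure B) inferInstance) B hB)
  exact Measurable.comp h hN

theorem IsRandomMeasure.measurable_integral [TopologicalSpace X] [BorelSpace X]
    {N : Ω → LocallyFiniteMeasure 𝓑} (hN : IsRandomMeasure N) {f : X → ℝ} (hf : f ∈ CBPlus 𝓑) :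
    Measurable fun ω => ∫ x, f x ∂(N ω).toMeasure := by
  -- After restriction to a bounded set, evaluation at any Borel set becomes evaluation at a bounded
  -- set.
  have hr : Measurable fun ω => (N ω).toMeasure.restrict (tsupport f) := by
    refine Measure.measurable_of_measurable_coe _ fun A hA => ?_
    simp_rw [Measure.restrict_apply hA]
    exact hN.measurable_apply (𝓑.mono _ _ (hA.inter (isClosed_tsupport f).measurableSet)
      Set.inter_subset_right hf.2.2.2)
  have heq : ∀ ω, ∫ x, f x ∂(N ω).toMeasure
      = (∫⁻ x, ENNReal.ofReal (f x) ∂(N ω).toMeasure.restrict (tsupport f)).toReal := by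
    intro ω
    rw [← setIntegral_eq_integral_of_forall_compl_eq_zero
        fun x hx => image_eq_zero_of_notMem_tsupport hx]
    exact integral_eq_lintegral_of_nonneg_ae (ae_of_all _ hf.2.1)
      hf.1.measurable.aestronglyMeasurable
  simp_rw [heq]
  exact ((Measure.measurable_lintegral hf.1.measurable.ennreal_ofReal).comp hr).ennreal_toReal

variable [MetricSpace X] [BorelSpace X]

theorem IsRandomMeasure.measurable_expMap {F : Set (X → ℝ)} (hF : F ⊆ LBPlus 𝓑)
    {N : Ω → LocallyFiniteMeasure 𝓑} (hN : IsRandomMeasure N) :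
    Measurable fun ω => expMap hF (N ω) :=
  measurable_pi_lambda _ fun h => Measurable.subtype_mk
    (hN.measurable_integral (LBPlus_subset_CBPlus (hF h.2))).neg.exp

/-- The vague Borel σ-algebra is pulled back from the cube, whose Borel σ-algebra is the product one
because `F` is countable; measurability can then be checked on coordinates. -/
theorem IsRandomMeasure.measurable {F : Set (X → ℝ)} (hF : IsDeterminingFamily 𝓑 F)
    {N : Ω → LocallyFiniteMeasure 𝓑} (hN : IsRandomMeasure N) : Measurable N := by
  have := hF.countable.to_subtype
  have hb : vagueBorel 𝓑 = MeasurableSpace.comap (expMap hF.subset) inferInstance := by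
    rw [BorelSpace.measurable_eq (α := F → unitInterval), ← borel_comap,
      ← hF.isInducing_expMap.eq_induced]
    rfl
  rw [hb]
  exact measurable_comap_iff.2 (hN.measurable_expMap hF.subset)

end Measurability

/-! ### Weak convergence on the cube and its transfer -/

section Convergence

/-- Convergence in distribution can be checked after composing with an inducing map. -/
theorem tendstoInDistribution_of_isInducing_comp {E K ι Ω' : Type*} {Ω : ι → Type*}
    [∀ i, MeasurableSpace (Ω i)] {P : ∀ i, Measure (Ω i)} [∀ i, IsProbabilityMeasure (P i)]
    [MeasurableSpace Ω'] {P' : Measure Ω'} [IsProbabilityMeasure P'] {l : Filter ι}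
    [l.IsCountablyGenerated] [TopologicalSpace E] [MeasurableSpace E] [BorelSpace E]
    [TopologicalSpace K] [MeasurableSpace K] [BorelSpace K] [HasOuterApproxClosed K]
    {Ψ : E → K} (hΨ : IsInducing Ψ)
    {Y : ∀ i, Ω i → E} {Z : Ω' → E} (hY : ∀ i, Measurable (Y i)) (hZ : Measurable Z)
    (h : TendstoInDistribution (fun i => Ψ ∘ Y i) l (Ψ ∘ Z) P P') :
    TendstoInDistribution Y l Z P P' where
  forall_aemeasurable i := (hY i).aemeasurable
  aemeasurable_limit := hZ.aemeasurable
  tendsto := by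
    refine tendsto_of_forall_isOpen_le_liminf' fun G hG => ?_
    obtain ⟨V, hV, rfl⟩ := hΨ.isOpen_iff.1 hG
    have hΨm : Measurable Ψ := hΨ.continuous.measurable
    have key := ProbabilityMeasure.le_liminf_measure_open_of_tendsto h.tendsto hV
    simp only [ProbabilityMeasure.coe_mk] at key ⊢
    rw [Measure.map_apply (hΨm.comp hZ) hV.measurableSet] at key
    rw [Measure.map_apply hZ hG.measurableSet]
    simp_rw [Measure.map_apply (hΨm.comp (hY _)) hV.measurableSet] at key
    simp_rw [Measure.map_apply (hY _) hG.measurableSet]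
    exact key

/-- On a compact space, weak convergence can be checked on a multiplicatively closed family whose
span separates points. -/
theorem tendsto_of_forall_mem_submonoidClosure {K ι : Type*} [TopologicalSpace K] [CompactSpace K]
    [MeasurableSpace K] [BorelSpace K] {l : Filter ι} {μs : ι → ProbabilityMeasure K}
    {μ : ProbabilityMeasure K} {S : Set C(K, ℝ)} (hS : (Algebra.adjoin ℝ S).SeparatesPoints)
    (h : ∀ g ∈ Submonoid.closure S, Tendsto (fun i => ∫ x, g x ∂(μs i : Measure K)) l
      (𝓝 (∫ x, g x ∂(μ : Measure K)))) :
    Tendsto μs l (𝓝 μ) := by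
  have hint : ∀ (ν : ProbabilityMeasure K) (g : C(K, ℝ)), Integrable g (ν : Measure K) :=
    fun ν g => (BoundedContinuousFunction.mkOfCompact g).integrable _
  have hadj : ∀ g ∈ Algebra.adjoin ℝ S, Tendsto (fun i => ∫ x, g x ∂(μs i : Measure K)) l
      (𝓝 (∫ x, g x ∂(μ : Measure K))) := by
    intro g hg
    rw [← Subalgebra.mem_toSubmodule, Algebra.adjoin_eq_span] at hg
    induction hg using Submodule.span_induction with
    | mem g hg => exact h g hg
    | zero => simpa using tendsto_const_nhds
    | add f g _ _ hf hg =>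
      simp only [ContinuousMap.add_apply]
      simp_rw [integral_add (hint _ f) (hint _ g)]
      exact hf.add hg
    | smul c f _ hf =>
      simp only [ContinuousMap.smul_apply, integral_smul]
      exact hf.const_smul c
  refine ProbabilityMeasure.tendsto_iff_forall_integral_tendsto.2 fun f => ?_
  rw [Metric.tendsto_nhds]
  intro ε hε
  -- Stone–Weierstrass; replacing `f` by `g` costs at most `ε / 3` in each integral, uniformly in
  -- the measure.
  obtain ⟨⟨g, hgA⟩, hg⟩ := ContinuousMap.exists_mem_subalgebra_near_continuousMap_of_separatesPoints
    _ hS f.toContinuousMap (ε / 3) (by positivity)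
  have hfg : ∀ ν : ProbabilityMeasure K,
      dist (∫ x, f x ∂(ν : Measure K)) (∫ x, g x ∂(ν : Measure K)) ≤ ε / 3 := by
    intro ν
    rw [dist_eq_norm, ← integral_sub (f.integrable _) (hint ν g)]
    refine (norm_integral_le_of_norm_le_const (C := ε / 3) (ae_of_all _ fun x => ?_)).trans
      (by simp)
    rw [norm_sub_rev]
    exact ((ContinuousMap.norm_coe_le_norm (g - f.toContinuousMap) x)).trans hg.le
  filter_upwards [Metric.tendsto_nhds.1 (hadj g hgA) (ε / 3) (by positivity)] with i hi
  have h1 := hfg (μs i)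
  have h2 := hfg μ
  rw [dist_comm] at h2
  linarith [dist_triangle4 (∫ x, f x ∂(μs i : Measure K)) (∫ x, g x ∂(μs i : Measure K))
    (∫ x, g x ∂(μ : Measure K)) (∫ x, f x ∂(μ : Measure K))]

variable {X : Type*} [MeasurableSpace X] {𝓑 : Boundedness X}

theorem tendsto_laplaceFunctional [TopologicalSpace X] {ι : Type*} {l : Filter ι} {Ω : ι → Type*}
    [∀ n, MeasurableSpace (Ω n)] {P : ∀ n, Measure (Ω n)} [∀ n, IsProbabilityMeasure (P n)]
    {Ω' : Type*} [MeasurableSpace Ω'] {P' : Measure Ω'} [IsProbabilityMeasure P']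
    {Y : ∀ n, Ω n → LocallyFiniteMeasure 𝓑} {Z : Ω' → LocallyFiniteMeasure 𝓑}
    (h : TendstoInDistribution Y l Z P P') {f : X → ℝ} (hf : f ∈ CBPlus 𝓑) :
    Tendsto (fun n => laplaceFunctional (P n) (Y n) f) l (𝓝 (laplaceFunctional P' Z f)) := by
  let g : BoundedContinuousFunction (LocallyFiniteMeasure 𝓑) ℝ :=
    BoundedContinuousFunction.ofNormedAddCommGroup
      (fun μ => Real.exp (-∫ x, f x ∂μ.toMeasure))
      (Real.continuous_exp.comp (continuous_integral hf).neg) 1 fun μ => by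
        rw [Real.norm_of_nonneg (Real.exp_pos _).le, Real.exp_le_one_iff, neg_nonpos]
        exact integral_nonneg hf.2.1
  have key := ProbabilityMeasure.tendsto_iff_forall_integral_tendsto.1 h.tendsto g
  simp only [ProbabilityMeasure.coe_mk] at key
  rw [integral_map h.aemeasurable_limit g.continuous.measurable.aestronglyMeasurable] at key
  simp_rw [integral_map (h.forall_aemeasurable _)
    g.continuous.measurable.aestronglyMeasurable] at key
  exact key

variable [MetricSpace X] [BorelSpace X]

theorem tendstoInDistribution_expMap {F : Set (X → ℝ)} (hFc : F.Countable) (hF : F ⊆ LBPlus 𝓑)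
    {Ω : ℕ → Type*} [∀ n, MeasurableSpace (Ω n)]
    {P : ∀ n, Measure (Ω n)} [∀ n, IsProbabilityMeasure (P n)]
    {Ω' : Type*} [MeasurableSpace Ω'] {P' : Measure Ω'} [IsProbabilityMeasure P']
    {Y : ∀ n, Ω n → LocallyFiniteMeasure 𝓑} (hY : ∀ n, IsRandomMeasure (Y n))
    {Z : Ω' → LocallyFiniteMeasure 𝓑} (hZ : IsRandomMeasure Z)
    (h : ∀ f ∈ LBPlus 𝓑, Tendsto (fun n => laplaceFunctional (P n) (Y n) f) atTop
      (𝓝 (laplaceFunctional P' Z f))) :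
    haveI := hFc.to_subtype
    TendstoInDistribution (fun n => expMap hF ∘ Y n) atTop (expMap hF ∘ Z) P P' := by
  have := hFc.to_subtype
  have hYm : ∀ n, Measurable (expMap hF ∘ Y n) := fun n => (hY n).measurable_expMap hF
  have hZm : Measurable (expMap hF ∘ Z) := hZ.measurable_expMap hF
  let c : F → C(F → unitInterval, ℝ) := fun h => ⟨fun p => p h, by fun_prop⟩
  refine ⟨fun n => (hYm n).aemeasurable, hZm.aemeasurable,
    tendsto_of_forall_mem_submonoidClosure (S := Set.range c) ?_ fun g hg => ?_⟩
  · intro p p' hpp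
    obtain ⟨h, hh⟩ := Function.ne_iff.1 hpp
    exact ⟨c h, ⟨c h, Algebra.subset_adjoin ⟨h, rfl⟩, rfl⟩, fun he => hh (Subtype.ext he)⟩
  · have hg' : g = 1 ∨ ∃ f ∈ LBPlus 𝓑, ∀ μ : LocallyFiniteMeasure 𝓑,
        g (expMap hF μ) = Real.exp (-∫ x, f x ∂μ.toMeasure) := by
      induction hg using Submonoid.closure_induction with
      | mem g hg =>
        obtain ⟨h, rfl⟩ := hg
        exact Or.inr ⟨h.1, hF h.2, fun μ => rfl⟩
      | one => exact Or.inl rfl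
      | mul g k _ _ hg hk =>
        rcases hg with rfl | ⟨f, hf, hg⟩
        · simpa using hk
        rcases hk with rfl | ⟨f', hf', hk⟩
        · exact Or.inr ⟨f, hf, by simpa using hg⟩
        refine Or.inr ⟨f + f', add_mem_LBPlus hf hf', fun μ => ?_⟩
        simp only [Pi.add_apply]
        rw [ContinuousMap.mul_apply, hg, hk, ← Real.exp_add,
          integral_add (integrable_of_mem_CBPlus (LBPlus_subset_CBPlus hf) μ)
            (integrable_of_mem_CBPlus (LBPlus_subset_CBPlus hf') μ), neg_add]
    simp only [ProbabilityMeasure.coe_mk]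
    rw [integral_map hZm.aemeasurable g.continuous.measurable.aestronglyMeasurable]
    simp_rw [integral_map (hYm _).aemeasurable g.continuous.measurable.aestronglyMeasurable]
    rcases hg' with rfl | ⟨f, hf, hg⟩
    · simp
    · simpa only [Function.comp_apply, hg, laplaceFunctional] using h f hf

end Convergence

end VagueConvergence

/-- Here `dist` on `X` is the metric `d`; the topology of the Polish space `X` is the one generated
by `d`, but `d` need not be complete and need not generate the family `𝓑` of bounded sets.
`Metric.cthickening ε B` is `{x | d(x, B) ≤ ε}`. -/
theorem proposition4p1
    {X : Type*} [MetricSpace X] [PolishSpace X] [MeasurableSpace X] [BorelSpace X]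
    (𝓑 : VagueConvergence.Boundedness X) (h𝓑 : 𝓑.ProperlyLocalizes)
    (hd : ∀ B ∈ 𝓑.sets, ∃ ε : ℝ, 0 < ε ∧ Metric.cthickening ε B ∈ 𝓑.sets)
    {Ω : ℕ → Type*} [∀ n, MeasurableSpace (Ω n)]
    (P : ∀ n, Measure (Ω n)) [∀ n, IsProbabilityMeasure (P n)]
    {Ω' : Type*} [MeasurableSpace Ω'] (P' : Measure Ω') [IsProbabilityMeasure P']
    (Nseq : ∀ n, Ω n → VagueConvergence.LocallyFiniteMeasure 𝓑)
    (hNseq : ∀ n, VagueConvergence.IsRandomMeasure (Nseq n))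
    (N : Ω' → VagueConvergence.LocallyFiniteMeasure 𝓑)
    (hN : VagueConvergence.IsRandomMeasure N) :
    TendstoInDistribution Nseq atTop N P P' ↔
      ∀ f ∈ VagueConvergence.LBPlus 𝓑,
        Tendsto (fun n => VagueConvergence.laplaceFunctional (P n) (Nseq n) f) atTop
          (𝓝 (VagueConvergence.laplaceFunctional P' N f)) := by
  obtain ⟨F, hF⟩ := VagueConvergence.exists_isDeterminingFamily h𝓑 hd
  have := hF.countable.to_subtype
  refine ⟨fun h f hf =>
    VagueConvergence.tendsto_laplaceFunctional h (VagueConvergence.LBPlus_subset_CBPlus hf),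
    fun h => ?_⟩
  exact VagueConvergence.tendstoInDistribution_of_isInducing_comp hF.isInducing_expMap
    (fun n => (hNseq n).measurable hF) (hN.measurable hF)
    (VagueConvergence.tendstoInDistribution_expMap hF.countable hF.subset hNseq hN h)
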